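/- Let $\mathbb K=\mathbb R$ or $\mathbb C$, and let $I=\mathbb N_0$ (unilateral case) or $I=\mathbb Z$ (bilateral case). Let $X$ be a Fréchet sequence space over $I$, i.e. a linear subspace of $\mathbb K^{I}$ with a complete topology given by a nondecreasing sequence of seminorms, for which all coordinate functionals $x\mapsto x_n$ are continuous. Assume that the unit sequences $(e_n)_{n\in I}$ form an unconditional basis of $X$, i.e. $e_n\in X$, $x=\sum_{n\in I} x_ne_n$ for every $x\in X$ (where, for $I=\mathbb Z$, the sum is the limit of $\sum_{n=M}^{N}x_ne_n$ as $M\to-\infty$ and $N\to\infty$), and $(a_nx_n)_n\in X$ for every $x\in X$ and every bounded scalar sequence $(a_n)_{n\in I}$. Assume that the backward shift $B:X\to X$, $(x_n)_n\mapsto(x_{n+1})_n$, is well defined. A vector $x$ is frequently recurrent for a map $T$ if, for every open set $U$ containing $x$, the set $A=\{n\in\mathbb N_0: T^n x\in U\}$ has positive lower density $\liminf_{n\to\infty}\frac{\#(A\cap[0,n])}{n+1}$; $T$ is frequently recurrent if its set of frequently recurrent vectors is dense; $x$ is cyclic for $T$ if the linear span of $\{T^nx:n\ge 0\}$ is dense;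 and a set $F$ is dense lineable if $F\cup\{0\}$ contains a dense linear subspace. Then $B$ is frequently recurrent if and only if there exists a vector that is both cyclic and frequently recurrent for $B$. In particular, if $B$ is frequently recurrent, then 1. the set of frequently recurrent vectors of $B$ is dense lineable, and moreover, 2. for every $n\in\mathbb N$, the set of frequently recurrent vectors of $B\times\cdots\times B:X^n\to X^n$ is dense lineable. -/

import Mathlib

open Filter Topology

/-- The lower density `liminf #(A ∩ [0,n]) / (n+1)` of a set of natural numbers. -/
noncomputable def lowerDensity (A : Set ℕ) : ℝ :=
  liminf (fun n : ℕ => ((A ∩ Set.Iic n).ncard : ℝ) / ((n : ℝ) + 1)) atTop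

/-- The set of hitting times `N_T(x, U)`. -/
def hittingTimes {Y : Type*} (T : Y → Y) (x : Y) (U : Set Y) : Set ℕ :=
  {n : ℕ | T^[n] x ∈ U}

/-- `x` is a frequently recurrent vector of `T`. -/
def IsFrequentlyRecurrentVector {Y : Type*} [TopologicalSpace Y] (T : Y → Y) (x : Y) : Prop :=
  ∀ U : Set Y, IsOpen U → x ∈ U → 0 < lowerDensity (hittingTimes T x U)

/-- `T` is frequently recurrent: its frequently recurrent vectors are dense. -/
def IsFrequentlyRecurrent {Y : Type*} [TopologicalSpace Y] (T : Y → Y) : Prop :=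
  Dense {x : Y | IsFrequentlyRecurrentVector T x}

/-- `x` is a cyclic vector of `T`: the linear span of its orbit is dense. -/
def IsCyclicVector (𝕜 : Type*) {Y : Type*} [Semiring 𝕜] [AddCommMonoid Y] [Module 𝕜 Y]
    [TopologicalSpace Y] (T : Y → Y) (x : Y) : Prop :=
  Dense (Submodule.span 𝕜 (Set.range fun n : ℕ => T^[n] x) : Set Y)

/-- `F ∪ {0}` contains a dense linear subspace. -/
def IsDenseLineable (𝕜 : Type*) {Y : Type*} [Semiring 𝕜] [AddCommMonoid Y] [Module 𝕜 Y]
    [TopologicalSpace Y] (F : Set Y) : Prop :=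
  ∃ V : Submodule 𝕜 Y, Dense (V : Set Y) ∧ (V : Set Y) ⊆ F ∪ {0}

/-- The `n`-fold product map `T × ⋯ × T` on `Yⁿ`. -/
def nfoldProduct {Y : Type*} (T : Y → Y) (n : ℕ) : (Fin n → Y) → (Fin n → Y) :=
  fun x i => T (x i)

/-- A Fréchet sequence space over the index set `ι`: the complete space `X` is identified, through
the injective map `coord`, with a linear subspace of `𝕜^ι`; its coordinate functionals are
continuous and its topology is given by a nondecreasing sequence of seminorms. (It is Hausdorff,
since the coordinate functionals are continuous and separate points.) -/
structure FrechetSequenceSpace (𝕜 : Type*) (ι : Type*) (X : Type*) [RCLike 𝕜]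
    [AddCommGroup X] [Module 𝕜 X] [UniformSpace X] [IsUniformAddGroup X] [CompleteSpace X] where
  /-- The sequence of coordinates of a vector. -/
  coord : X →ₗ[𝕜] (ι → 𝕜)
  coord_injective : Function.Injective coord
  continuous_coord : ∀ n : ι, Continuous fun x : X => coord x n
  /-- The seminorms that define the topology. -/
  seminorm : ℕ → Seminorm 𝕜 X
  seminorm_mono : Monotone seminorm
  withSeminorms : WithSeminorms seminorm

namespace FrechetSequenceSpace

variable {𝕜 ι X : Type*} [RCLike 𝕜]
  [AddCommGroup X] [Module 𝕜 X] [UniformSpace X] [IsUniformAddGroup X] [CompleteSpace X]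

/-- The canonical unit vectors `e n` belong to the space and form an unconditional basis of it:
every `x` is the sum of the (ordered) series `∑ xₙ eₙ`, and `(aₙ xₙ)ₙ` belongs to the space for all
`x` in the space and all bounded scalar sequences `a`.
For `ι = ℕ` the partial sums run over `[0, N]`, for `ι = ℤ` over `[M, N]`, as
`M → -∞` and `N → ∞`. -/
structure IsUnconditionalBasis [DecidableEq ι] [Preorder ι] [LocallyFiniteOrder ι]
    (S : FrechetSequenceSpace 𝕜 ι X) (e : ι → X) : Prop where
  coord_basis : ∀ n : ι, S.coord (e n) = Pi.single n 1
  expansion : ∀ x : X, HasSum (fun n => S.coord x n • e n) x (SummationFilter.conditional ι)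
  mul_mem : ∀ a : ι → 𝕜, (∃ M : ℝ, ∀ n, ‖a n‖ ≤ M) →
    ∀ x : X, ∃ y : X, ∀ n, S.coord y n = a n * S.coord x n

/-- `B` is the backward shift `(xₙ)ₙ ↦ (xₙ₊₁)ₙ` on the space. -/
def IsBackwardShift [Add ι] [One ι] (S : FrechetSequenceSpace 𝕜 ι X) (B : X → X) : Prop :=
  ∀ (x : X) (n : ι), S.coord (B x) n = S.coord x (n + 1)

end FrechetSequenceSpace

/-! The main step is to turn a frequently recurrent `x` with a nonzero coordinate into a frequently
recurrent cyclic vector `y`, by restricting `x` to a set `s` of coordinates. Since `x` returns close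
to itself, erasing coordinates gives control: at a return time `n`, the window of `T^[n] y` around
the origin is nearly any pattern cut out of `x` that `s` prescribes around `n`.

The return times to the `m`-th neighbourhood of `x` are thinned to sets of positive lower density
whose windows are pairwise disjoint (`exists_separated_family`). Around half of these sets `s`
copies its own central window, which makes `y` frequently recurrent; around the others it holds a
single prescribed point, so that the orbit of `y` accumulates at nonzero multiples of unit vectors
arbitrarily far to the right (`exists_recurrent_set`). Shifting these back yields all unit vectors,
hence cyclicity.

Unconditionality supplies continuous seminorms monotone in the moduli of the coordinates
(`exists_isSolid`). For these, the error outside the window is controlled by a tail of `x` and by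
`T^[n] x - x` (`IsSolid.apply_sub_le`).

Everything else follows from one remark: polynomials in `T` commute with `T`, so they preserve
frequent recurrence, and so do tuples of them as maps into the product. -/

/-! ### Positive lower density and separated sets of times. -/

theorem lowerDensity_pos_iff (A : Set ℕ) :
    0 < lowerDensity A ↔
      ∃ b N₀ : ℕ, ∀ N, N₀ ≤ N → N + 1 ≤ b * (A ∩ Set.Iic N).ncard := by
  have hle : ∀ n : ℕ, ((A ∩ Set.Iic n).ncard : ℝ) / ((n : ℝ) + 1) ≤ 1 := by
    intro n
    rw [div_le_one (by positivity)]
    have h := Set.ncard_le_ncard (Set.inter_subset_right (s := A) (t := Set.Iic n))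
      (Set.finite_Iic n)
    have h2 : (Set.Iic n).ncard = n + 1 := by
      rw [← Finset.coe_Iic, Set.ncard_coe_finset]; simp
    rw [h2] at h
    exact_mod_cast h
  constructor
  · intro h
    obtain ⟨c, hc0, hc⟩ := exists_between h
    have hb : IsBoundedUnder (· ≥ ·) atTop
        (fun n : ℕ => ((A ∩ Set.Iic n).ncard : ℝ) / ((n : ℝ) + 1)) :=
      isBoundedUnder_of ⟨0, fun n => by positivity⟩
    have hev := eventually_lt_of_lt_liminf hc hb
    obtain ⟨N₀, hN₀⟩ := eventually_atTop.1 hev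
    obtain ⟨b, hb⟩ := exists_nat_ge (1 / c)
    refine ⟨b, N₀, fun N hN => ?_⟩
    have h1 := hN₀ N hN
    rw [lt_div_iff₀ (by positivity)] at h1
    rw [div_le_iff₀ hc0] at hb
    have : ((N : ℝ) + 1) ≤ b * (A ∩ Set.Iic N).ncard := by
      calc ((N : ℝ) + 1) = 1 * ((N : ℝ) + 1) := by ring
        _ ≤ (b * c) * ((N : ℝ) + 1) := by gcongr
        _ = b * (c * ((N : ℝ) + 1)) := by ring
        _ ≤ _ := by gcongr
    exact_mod_cast this
  · rintro ⟨b, N₀, h⟩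
    have hbpos : 0 < b := by
      rcases Nat.eq_zero_or_pos b with rfl | hb
      · have := h N₀ le_rfl
        simp at this
      · exact hb
    have hbR : (0 : ℝ) < b := by exact_mod_cast hbpos
    refine lt_of_lt_of_le (by positivity : (0 : ℝ) < 1 / b) (le_liminf_of_le ?_ ?_)
    · exact (isBoundedUnder_of ⟨1, hle⟩ : IsBoundedUnder (· ≤ ·) atTop _).isCoboundedUnder_ge
    · filter_upwards [eventually_ge_atTop N₀] with N hN
      rw [div_le_div_iff₀ hbR (by positivity)]
      have := h N hN
      have h' : ((N : ℝ) + 1) ≤ b * (A ∩ Set.Iic N).ncard := by exact_mod_cast this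
      linarith

theorem lowerDensity_pos_mono {A A' : Set ℕ} (h : A ⊆ A') (hA : 0 < lowerDensity A) :
    0 < lowerDensity A' := by
  rw [lowerDensity_pos_iff] at hA ⊢
  obtain ⟨b, N₀, hb⟩ := hA
  refine ⟨b, N₀, fun N hN => (hb N hN).trans ?_⟩
  gcongr
  exact (Set.finite_Iic N).inter_of_right _

theorem infinite_of_lowerDensity_pos {A : Set ℕ} (hA : 0 < lowerDensity A) : A.Infinite := by
  intro hfin
  obtain ⟨b, N₀, hb⟩ := (lowerDensity_pos_iff A).1 hA
  have h1 := hb (N₀ + b * A.ncard) (by omega)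
  have h2 : (A ∩ Set.Iic (N₀ + b * A.ncard)).ncard ≤ A.ncard :=
    Set.ncard_le_ncard Set.inter_subset_left hfin
  have h3 := Nat.mul_le_mul_left b h2
  omega

/-- Keeping every `g`-th element of an infinite set of natural numbers. -/
theorem exists_thinning {A : Set ℕ} (hA : A.Infinite) {g : ℕ} (hg : 0 < g) :
    ∃ D ⊆ A, (∀ n ∈ D, g ≤ n) ∧ (∀ n ∈ D, ∀ n' ∈ D, n < n' → n + g ≤ n') ∧
      (∀ N, (A ∩ Set.Iic N).ncard ≤ g * ((D ∩ Set.Iic N).ncard + 1)) ∧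
      ∀ N, (D ∩ Set.Iic N).ncard * g ≤ N := by
  classical
  have hinf : (Set.ofPred (· ∈ A)).Infinite := hA
  -- The rank of `n` in `A` must be a positive multiple of `g`. Leaving out rank 0 forces `g ≤ n`
  -- and gives the last count without an additive constant.
  set D : Set ℕ := {n | n ∈ A ∧ g ∣ Nat.count (· ∈ A) n ∧ 0 < Nat.count (· ∈ A) n} with hD
  have hstep : ∀ n m, n ≤ m → Nat.count (· ∈ A) m ≤ Nat.count (· ∈ A) n + (m - n) := by
    intro n m h
    obtain ⟨k, rfl⟩ := Nat.exists_eq_add_of_le h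
    rw [Nat.count_add]
    have := Nat.count_le (fun x => n + x ∈ A) (n := k)
    omega
  refine ⟨D, fun n hn => hn.1, ?_, ?_, ?_, ?_⟩
  · rintro n ⟨-, h1, h2⟩
    exact (Nat.le_of_dvd h2 h1).trans (Nat.count_le _)
  · rintro n ⟨hn, h1, -⟩ n' ⟨hn', h1', -⟩ hlt
    have h3 : Nat.count (· ∈ A) n < Nat.count (· ∈ A) n' := Nat.count_strict_mono hn hlt
    have h4 := hstep n n' hlt.le
    have h5 : g ∣ Nat.count (· ∈ A) n' - Nat.count (· ∈ A) n := Nat.dvd_sub h1' h1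
    have h6 := Nat.le_of_dvd (by omega) h5
    omega
  · intro N
    set M := (A ∩ Set.Iic N).ncard with hM
    have hMc : M = Nat.count (· ∈ A) (N + 1) := by
      rw [hM, Nat.count_eq_card_filter_range, ← Set.ncard_coe_finset]
      congr 1
      ext n
      simp [and_comm]
    have hcard : (M - 1) / g ≤ (D ∩ Set.Iic N).ncard := by
      have h1 : ((Finset.Icc 1 ((M - 1) / g)).image fun k => Nat.nth (· ∈ A) (k * g) : Set ℕ) ⊆
          D ∩ Set.Iic N := by
        intro n hn
        simp only [Finset.coe_image, Set.mem_image, Finset.coe_Icc, Set.mem_Icc] at hn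
        obtain ⟨k, ⟨hk1, hk2⟩, rfl⟩ := hn
        have hk3 : k * g ≤ M - 1 := (Nat.le_div_iff_mul_le hg).1 hk2
        have hpos : 0 < k * g := Nat.mul_pos hk1 hg
        refine ⟨⟨Nat.nth_mem_of_infinite hinf _, ?_, ?_⟩, ?_⟩
        · rw [Nat.count_nth_of_infinite hinf]; exact Dvd.intro_left k rfl
        · rw [Nat.count_nth_of_infinite hinf]; exact hpos
        · have := Nat.nth_lt_of_lt_count (p := (· ∈ A)) (n := N + 1) (k := k * g) (by omega)
          exact Nat.lt_succ_iff.1 this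
      have h2 := Set.ncard_le_ncard h1 ((Set.finite_Iic N).inter_of_right _)
      rw [Set.ncard_coe_finset, Finset.card_image_of_injective] at h2
      · simpa using h2
      · intro a b hab
        exact Nat.eq_of_mul_eq_mul_right hg (Nat.nth_injective hinf hab)
    have h3 := Nat.lt_mul_div_succ (M - 1) hg
    have h4 : g * ((M - 1) / g + 1) ≤ g * ((D ∩ Set.Iic N).ncard + 1) := by gcongr
    omega
  · intro N
    rw [← Nat.le_div_iff_mul_le hg]
    have h1 : Set.InjOn (fun n => Nat.count (· ∈ A) n / g) (D ∩ Set.Iic N) := by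
      rintro n ⟨⟨hn, h1, -⟩, -⟩ n' ⟨⟨hn', h1', -⟩, -⟩ h
      exact Nat.count_injective hn hn' (Nat.div_left_inj h1 h1' |>.1 h)
    have h2 : (fun n => Nat.count (· ∈ A) n / g) '' (D ∩ Set.Iic N) ⊆
        (Finset.Icc 1 (N / g) : Set ℕ) := by
      rintro _ ⟨n, ⟨⟨hn, h1, h2⟩, hN⟩, rfl⟩
      simp only [Finset.coe_Icc, Set.mem_Icc]
      refine ⟨Nat.div_pos (Nat.le_of_dvd h2 h1) hg, Nat.div_le_div_right ?_⟩
      exact (Nat.count_le _).trans hN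
    have h3 := Set.ncard_le_ncard h2 (Finset.finite_toSet _)
    rw [h1.ncard_image, Set.ncard_coe_finset] at h3
    simpa using h3

/-- Strong recursion: the value at `n` is the sum of all lower bounds imposed by earlier indices. -/
theorem exists_nat_seq_ge (H : ℕ → ℕ → ℕ → ℕ) :
    ∃ g : ℕ → ℕ, ∀ m m', m < m' → H m m' (g m) ≤ g m' := by
  let F : (n : ℕ) → ((m : ℕ) → m < n → ℕ) → ℕ := fun n f => ∑ m : Fin n, H m n (f m m.2)
  refine ⟨fun n => Nat.strongRec F n, fun m m' h => ?_⟩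
  have h1 : (Nat.strongRec F m' : ℕ) = F m' fun k _ => Nat.strongRec F k := by
    rw [Nat.strongRec_eq]
  change _ ≤ (Nat.strongRec F m' : ℕ)
  rw [h1]
  exact Finset.single_le_sum (f := fun k : Fin m' => H k m' (Nat.strongRec F k.1))
    (fun _ _ => Nat.zero_le _) (Finset.mem_univ (⟨m, h⟩ : Fin m'))

theorem sum_Ioc_half_pow_le (m N : ℕ) : ∑ k ∈ Finset.Ioc m N, (1 / 2 : ℚ) ^ k ≤ 1 := by
  have h1 : ∀ N : ℕ, ∑ k ∈ Finset.Ioc 0 N, (1 / 2 : ℚ) ^ k = 1 - (1 / 2) ^ N := by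
    intro N
    induction N with
    | zero => simp
    | succ n ih => rw [Finset.sum_Ioc_succ_top (Nat.zero_le n), ih]; ring
  calc ∑ k ∈ Finset.Ioc m N, (1 / 2 : ℚ) ^ k ≤ ∑ k ∈ Finset.Ioc 0 N, (1 / 2 : ℚ) ^ k :=
        Finset.sum_le_sum_of_subset_of_nonneg
          (Finset.Ioc_subset_Ioc_left (Nat.zero_le m)) fun _ _ _ => by positivity
    _ ≤ 1 := by rw [h1]; linarith [show (0 : ℚ) ≤ (1 / 2) ^ N by positivity]

/-- The relevant centres are at most `N + r`. If there is one, then `2 * r ≤ g ≤ N + r`, so `N + r ≤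
2 * N`; each centre accounts for at most `2 * r + 1` points. -/
theorem ncard_neighborhood_mul_le {D : Set ℕ} {g r N : ℕ} (hg : 2 * r ≤ g)
    (hDg : ∀ n ∈ D, g ≤ n) (hD : ∀ N, (D ∩ Set.Iic N).ncard * g ≤ N) :
    ({n | ∃ n' ∈ D, n ≤ n' + r ∧ n' ≤ n + r} ∩ Set.Iic N).ncard * g ≤ (2 * r + 1) * (2 * N) := by
  have hfin : (D ∩ Set.Iic (N + r)).Finite := (Set.finite_Iic _).inter_of_right _
  have hcov : ({n | ∃ n' ∈ D, n ≤ n' + r ∧ n' ≤ n + r} ∩ Set.Iic N) ⊆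
      (hfin.toFinset.biUnion fun n' => Finset.Icc (n' - r) (n' + r) : Set ℕ) := by
    rintro n ⟨⟨n', hn', h1, h2⟩, hN⟩
    simp only [Set.mem_Iic] at hN
    simp only [Finset.coe_biUnion, Set.mem_iUnion, Finset.mem_coe, Set.Finite.mem_toFinset,
      Finset.coe_Icc, Set.mem_Icc]
    exact ⟨n', ⟨hn', by simp only [Set.mem_Iic]; omega⟩, by omega, by omega⟩
  have h1 := Set.ncard_le_ncard hcov (Finset.finite_toSet _)
  rw [Set.ncard_coe_finset] at h1
  have h2 : (hfin.toFinset.biUnion fun n' => Finset.Icc (n' - r) (n' + r)).card ≤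
      hfin.toFinset.card * (2 * r + 1) := by
    refine Finset.card_biUnion_le_card_mul _ _ _ fun n' _ => ?_
    rw [Nat.card_Icc]
    omega
  rw [← Set.ncard_eq_toFinset_card _ hfin] at h2
  have h3 : (D ∩ Set.Iic (N + r)).ncard * g ≤ 2 * N := by
    rcases (D ∩ Set.Iic (N + r)).eq_empty_or_nonempty with h | ⟨n, hn, hn'⟩
    · simp [h]
    · have h4 := hD (N + r)
      have h5 := hDg n hn
      simp only [Set.mem_Iic] at hn'
      omega
  calc _ ≤ ((D ∩ Set.Iic (N + r)).ncard * (2 * r + 1)) * g := by gcongr; exact h1.trans h2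
    _ = (2 * r + 1) * ((D ∩ Set.Iic (N + r)).ncard * g) := by ring
    _ ≤ _ := by gcongr

/-- Sets of positive lower density can be thinned to sets of positive lower density whose elements
are all far apart, also across different sets. -/
theorem exists_separated_family (A : ℕ → Set ℕ) (hA : ∀ m, 0 < lowerDensity (A m)) :
    ∃ G : ℕ → Set ℕ, (∀ m, G m ⊆ A m) ∧ (∀ m, 0 < lowerDensity (G m)) ∧
      ∀ m m', ∀ n ∈ G m, ∀ n' ∈ G m', n ≤ n' → (m = m' ∧ n = n') ∨ n + (m + m') < n' := by
  classical
  choose b N₀ hb using fun m => (lowerDensity_pos_iff (A m)).1 (hA m)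
  -- With this growth, the `2 * m'`-neighbourhood of `D m'` has at most `2 ^ (-m') * N / (4 * b m *
  -- g m)` points up to `N`. Summed over `m' > m`, this is a quarter of the density `1 / (b m * g
  -- m)` guaranteed for `D m`.
  obtain ⟨g₀, hg₀⟩ := exists_nat_seq_ge fun m m' x =>
    2 ^ m' * (4 * m' + 1) * 8 * b m * (x + 4 * m + 1)
  obtain ⟨g, hgdef⟩ : ∃ g : ℕ → ℕ, g = fun m => g₀ m + 4 * m + 1 := ⟨_, rfl⟩
  have hg4 : ∀ m, 4 * m + 1 ≤ g m := fun m => by rw [hgdef]; simp only; omega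
  have hg : ∀ m m', m < m' → 2 ^ m' * (4 * m' + 1) * 8 * b m * g m ≤ g m' := by
    intro m m' h
    rw [hgdef]
    exact (hg₀ m m' h).trans (by simp only; omega)
  choose D hDA hDg hDsep hDlow hDup using fun m =>
    exists_thinning (infinite_of_lowerDensity_pos (hA m)) (lt_of_lt_of_le (Nat.succ_pos _) (hg4 m))
  let Bad : ℕ → Set ℕ := fun m => {n | ∃ n' ∈ D m, n ≤ n' + 2 * m ∧ n' ≤ n + 2 * m}
  -- A conflict between two levels is resolved by deleting the point of the lower level; the radius
  -- `2 * m'` exceeds `m + m'` when `m < m'`.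
  refine ⟨fun m => {n | n ∈ D m ∧ ∀ m', m < m' → n ∉ Bad m'}, fun m n hn => hDA m hn.1, ?_, ?_⟩
  · intro m
    have hbpos : 0 < b m := by
      rcases Nat.eq_zero_or_pos (b m) with h | h
      · have := hb m (N₀ m) le_rfl
        simp [h] at this
      · exact h
    have hgpos : 0 < g m := lt_of_lt_of_le (Nat.succ_pos _) (hg4 m)
    rw [lowerDensity_pos_iff]
    -- The term `2 * b m * g m` makes `N` large enough to absorb the `+ 1` in the lower count of the
    -- thinned set.
    refine ⟨4 * b m * g m, N₀ m + 2 * b m * g m, fun N hN => ?_⟩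
    beta_reduce
    have hbad : ∀ m', m < m' →
        ((Bad m' ∩ Set.Iic N).ncard : ℚ) * (4 * b m * g m) ≤ N * (1 / 2) ^ m' := by
      intro m' hm'
      have h1 := ncard_neighborhood_mul_le (r := 2 * m') (N := N) (by have := hg4 m'; omega)
        (hDg m') (hDup m')
      have h2 : (Bad m' ∩ Set.Iic N).ncard * (2 ^ m' * (4 * m' + 1) * 8 * b m * g m) ≤
          (2 * (2 * m') + 1) * (2 * N) := (Nat.mul_le_mul_left _ (hg m m' hm')).trans h1
      have h3 : (2 * (4 * m' + 1)) * ((Bad m' ∩ Set.Iic N).ncard * (4 * b m * g m) * 2 ^ m') ≤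
          (2 * (4 * m' + 1)) * N := by
        calc _ = (Bad m' ∩ Set.Iic N).ncard * (2 ^ m' * (4 * m' + 1) * 8 * b m * g m) := by ring
          _ ≤ _ := h2
          _ = _ := by ring
      have h4 := Nat.le_of_mul_le_mul_left h3 (by positivity)
      rw [one_div, inv_pow, ← div_eq_mul_inv, le_div_iff₀ (by positivity)]
      exact_mod_cast h4
    -- Only levels `m' ≤ N` matter: `D m'` starts beyond `4 * m'`, so its neighbourhood starts
    -- beyond `2 * m'`.
    have hcov : D m ∩ Set.Iic N ⊆ ({n | n ∈ D m ∧ ∀ m', m < m' → n ∉ Bad m'} ∩ Set.Iic N) ∪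
        ⋃ m' ∈ Finset.Ioc m N, Bad m' ∩ Set.Iic N := by
      rintro n ⟨hn, hnN⟩
      by_cases hgood : ∀ m', m < m' → n ∉ Bad m'
      · exact Or.inl ⟨⟨hn, hgood⟩, hnN⟩
      · push Not at hgood
        obtain ⟨m', hm', hb'⟩ := hgood
        refine Or.inr ?_
        simp only [Set.mem_iUnion]
        refine ⟨m', ?_, hb', hnN⟩
        obtain ⟨n', hn', h1, h2⟩ := hb'
        have h3 := hDg m' n' hn'
        have h4 := hg4 m'
        simp only [Set.mem_Iic] at hnN
        rw [Finset.mem_Ioc]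
        omega
    have hfin : ∀ T : Set ℕ, (T ∩ Set.Iic N).Finite := fun T => (Set.finite_Iic N).inter_of_right _
    have hc1 : (D m ∩ Set.Iic N).ncard ≤
        ({n | n ∈ D m ∧ ∀ m', m < m' → n ∉ Bad m'} ∩ Set.Iic N).ncard +
          ∑ m' ∈ Finset.Ioc m N, (Bad m' ∩ Set.Iic N).ncard := by
      refine (Set.ncard_le_ncard hcov ((hfin _).union
        (Set.Finite.biUnion (Finset.finite_toSet _) fun _ _ => hfin _))).trans ?_
      refine (Set.ncard_union_le _ _).trans ?_
      gcongr
      exact Finset.set_ncard_biUnion_le _ _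
    have hc2 : ((∑ m' ∈ Finset.Ioc m N, (Bad m' ∩ Set.Iic N).ncard : ℕ) : ℚ) *
        (4 * b m * g m) ≤ N := by
      push_cast
      rw [Finset.sum_mul]
      calc _ ≤ ∑ m' ∈ Finset.Ioc m N, (N : ℚ) * (1 / 2) ^ m' :=
            Finset.sum_le_sum fun m' hm' => hbad m' (Finset.mem_Ioc.1 hm').1
        _ = N * ∑ m' ∈ Finset.Ioc m N, (1 / 2 : ℚ) ^ m' := by rw [Finset.mul_sum]
        _ ≤ N * 1 := by gcongr; exact sum_Ioc_half_pow_le m N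
        _ = N := mul_one _
    have hc3 : (∑ m' ∈ Finset.Ioc m N, (Bad m' ∩ Set.Iic N).ncard) * (4 * b m * g m) ≤ N := by
      exact_mod_cast hc2
    have hc4 : N + 1 ≤ b m * (g m * ((D m ∩ Set.Iic N).ncard + 1)) :=
      (hb m N (by omega)).trans (Nat.mul_le_mul_left _ (hDlow m N))
    have hc5 := Nat.mul_le_mul_left (4 * b m * g m) hc1
    have e1 : b m * (g m * ((D m ∩ Set.Iic N).ncard + 1)) =
      b m * g m * (D m ∩ Set.Iic N).ncard + b m * g m := by ring
    have e2 : 4 * b m * g m * (D m ∩ Set.Iic N).ncard =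
      4 * (b m * g m * (D m ∩ Set.Iic N).ncard) := by ring
    have e3 : 2 * b m * g m = 2 * (b m * g m) := by ring
    rw [e1] at hc4
    rw [e2, mul_add] at hc5
    rw [e3] at hN
    rw [mul_comm] at hc3
    omega
  · rintro m m' n ⟨hn, hgn⟩ n' ⟨hn', hgn'⟩ hle
    rcases lt_trichotomy m m' with h | rfl | h
    · right
      by_contra hcon
      exact hgn m' h ⟨n', hn', by omega, by omega⟩
    · rcases hle.eq_or_lt with h | h
      · exact Or.inl ⟨rfl, h⟩
      · have := hDsep m n hn n' hn' h
        have := hg4 m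
        omega
    · right
      by_contra hcon
      exact hgn' m h ⟨n, hn, by omega, by omega⟩

/-! ### The self-copying set of coordinates. -/

/-- The set of integers obtained by copying, around every point of `G ℓ` with `ℓ` even, the part of
the set itself in `[-ℓ, ℓ]` and by placing, around every point of `G ℓ` with `ℓ` odd, the single
point `J ℓ`. -/
inductive CopiedSet (G : ℕ → Set ℕ) (J : ℕ → ℤ) : ℤ → Prop
  | copy (l n : ℕ) (i : ℤ) (hl : Even l) (hn : n ∈ G l) (hi : |i| ≤ l) (h : CopiedSet G J i) :
      CopiedSet G J (n + i)
  | point (l n : ℕ) (hl : ¬ Even l) (hn : n ∈ G l) (hi : |J l| ≤ l) : CopiedSet G J (n + J l)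

theorem exists_recurrent_set (A : ℕ → Set ℕ) (hA : ∀ m, 0 < lowerDensity (A m)) (J : ℕ → ℤ) :
    ∃ s : Set ℤ,
      (∀ m, 0 < lowerDensity
        {n | n ∈ A m ∧ ∀ i : ℤ, |i| ≤ m → ((n : ℤ) + i ∈ s ↔ i ∈ s)}) ∧
      ∀ m, ∃ n ∈ A m, ∀ i : ℤ, |i| ≤ m → ((n : ℤ) + i ∈ s ↔ i = J m) := by
  -- Halving the index uses each `A m` twice: at level `2 * m` for copying and at `2 * m + 1` for
  -- the isolated point. By `huniq`, the windows are disjoint, so a point in a window can only come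
  -- from that window's own rule.
  obtain ⟨G, hGA, hG, hsep⟩ := exists_separated_family (fun l => A (l / 2)) fun l => hA _
  have huniq : ∀ (l l' n n' : ℕ) (i i' : ℤ), n ∈ G l → n' ∈ G l' → |i| ≤ l → |i'| ≤ l' →
      (n : ℤ) + i = n' + i' → l = l' ∧ n = n' := by
    intro l l' n n' i i' hn hn' hi hi' h
    rw [abs_le] at hi hi'
    rcases le_total n n' with hle | hle
    · rcases hsep l l' n hn n' hn' hle with h1 | h1
      · exact h1
      · omega
    · rcases hsep l' l n' hn' n hn hle with h1 | h1
      · exact ⟨h1.1.symm, h1.2.symm⟩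
      · omega
  let J' : ℕ → ℤ := fun l => J (l / 2)
  refine ⟨{k | CopiedSet G J' k}, fun m => ?_, fun m => ?_⟩
  · refine lowerDensity_pos_mono (A := G (2 * m)) (fun n hn => ⟨?_, fun i hi => ?_⟩) (hG _)
    · simpa using hGA _ hn
    · have hi2 : |i| ≤ ((2 * m : ℕ) : ℤ) := by push_cast; omega
      refine ⟨fun h => ?_, fun h => .copy (2 * m) n i (even_two_mul m) hn hi2 h⟩
      simp only [Set.mem_ofPred_eq] at h ⊢
      generalize hk : (n : ℤ) + i = k at h
      cases h with
      | copy l n' i' hl hn' hi' h' =>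
        obtain ⟨rfl, rfl⟩ := huniq _ _ _ _ _ _ hn hn' hi2 hi' hk
        rwa [show i = i' by omega]
      | point l n' hl hn' hi' =>
        obtain ⟨rfl, rfl⟩ := huniq _ _ _ _ _ _ hn hn' hi2 hi' hk
        exact absurd (even_two_mul m) hl
  · obtain ⟨n, hn⟩ := (infinite_of_lowerDensity_pos (hG (2 * m + 1))).nonempty
    have hdiv : (2 * m + 1) / 2 = m := by omega
    have hodd : ¬ Even (2 * m + 1) := by simp [parity_simps]
    refine ⟨n, by simpa [hdiv] using hGA _ hn, fun i hi => ?_⟩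
    have hi2 : |i| ≤ ((2 * m + 1 : ℕ) : ℤ) := by push_cast; omega
    simp only [Set.mem_ofPred_eq]
    constructor
    · intro h
      generalize hk : (n : ℤ) + i = k at h
      cases h with
      | copy l n' i' hl hn' hi' h' =>
        obtain ⟨rfl, rfl⟩ := huniq _ _ _ _ _ _ hn hn' hi2 hi' hk
        exact absurd hl hodd
      | point l n' hl hn' hi' =>
        obtain ⟨rfl, rfl⟩ := huniq _ _ _ _ _ _ hn hn' hi2 hi' hk
        simp only [J', hdiv] at hk
        omega
    · rintro rfl
      have := CopiedSet.point (G := G) (J := J') (2 * m + 1) n hodd hn (by simpa [J', hdiv] using hi2)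
      simpa [J', hdiv] using this

/-! ### Unconditional bases and solid seminorms. -/

namespace FrechetSequenceSpace

variable {𝕜 ι X : Type*} [RCLike 𝕜]
  [AddCommGroup X] [Module 𝕜 X] [UniformSpace X] [IsUniformAddGroup X] [CompleteSpace X]

theorem continuousSMul (S : FrechetSequenceSpace 𝕜 ι X) : ContinuousSMul 𝕜 X :=
  S.withSeminorms.continuousSMul

theorem t2Space (S : FrechetSequenceSpace 𝕜 ι X) : T2Space X :=
  T2Space.of_injective_continuous S.coord_injective (continuous_pi S.continuous_coord)

theorem barrelledSpace (S : FrechetSequenceSpace 𝕜 ι X) : BarrelledSpace 𝕜 X := by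
  have := S.continuousSMul
  have := S.withSeminorms.firstCountableTopology
  have : (uniformity X).IsCountablyGenerated := IsUniformAddGroup.uniformity_countably_generated
  have : BaireSpace X := inferInstance
  infer_instance

/-- A seminorm that is monotone in the absolute values of the coordinates. -/
def IsSolid (S : FrechetSequenceSpace 𝕜 ι X) (q : Seminorm 𝕜 X) : Prop :=
  ∀ x y : X, (∀ i, ‖S.coord y i‖ ≤ ‖S.coord x i‖) → q y ≤ q x

/-- The multiplication of the coordinates in `F` by `a`. -/
noncomputable def multiplierSum (S : FrechetSequenceSpace 𝕜 ι X) (e : ι → X) (F : Finset ι)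
    (a : ι → 𝕜) : X →ₗ[𝕜] X :=
  ∑ i ∈ F, (a i • (LinearMap.proj i ∘ₗ S.coord)).smulRight (e i)

theorem multiplierSum_apply (S : FrechetSequenceSpace 𝕜 ι X) (e : ι → X) (F : Finset ι)
    (a : ι → 𝕜) (x : X) :
    S.multiplierSum e F a x = ∑ i ∈ F, (a i * S.coord x i) • e i := by
  simp [multiplierSum, LinearMap.sum_apply]

theorem continuous_multiplierSum (S : FrechetSequenceSpace 𝕜 ι X) (e : ι → X) (F : Finset ι)
    (a : ι → 𝕜) : Continuous (S.multiplierSum e F a) := by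
  have := S.continuousSMul
  have h := S.continuous_coord
  have h2 : ⇑(S.multiplierSum e F a) = fun x => ∑ i ∈ F, (a i * S.coord x i) • e i :=
    funext (S.multiplierSum_apply e F a)
  rw [h2]
  exact continuous_finsetSum _ fun i _ => (continuous_const.mul (h i)).smul continuous_const

theorem coord_sum_smul [DecidableEq ι] {S : FrechetSequenceSpace 𝕜 ι X} {e : ι → X}
    (he : ∀ i, S.coord (e i) = Pi.single i 1) (F : Finset ι) (a : ι → 𝕜) (i : ι) :
    S.coord (∑ j ∈ F, a j • e j) i = if i ∈ F then a i else 0 := by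
  simp [map_sum, he, Pi.single_apply]

theorem exists_subset_of_exhaustion {W : ℕ → Finset ι} (hW : Monotone W) (hex : ∀ i, ∃ K, i ∈ W K)
    (F : Finset ι) (K : ℕ) : ∃ L, K < L ∧ F ⊆ W L := by
  choose k hk using hex
  refine ⟨K + 1 + F.sup k, by omega, fun i hi => hW ?_ (hk i)⟩
  exact (Finset.le_sup (f := k) hi).trans (Nat.le_add_left _ _)

/-- The expansions of the vectors of the space converge unconditionally. -/
theorem exists_tail_le {S : FrechetSequenceSpace 𝕜 ι X} {e : ι → X} {W : ℕ → Finset ι}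
    (hW : Monotone W) (hex : ∀ i, ∃ K, i ∈ W K)
    (hexp : ∀ x, Tendsto (fun K => ∑ i ∈ W K, S.coord x i • e i) atTop (𝓝 x))
    (hmul : ∀ a : ι → 𝕜, (∃ M : ℝ, ∀ n, ‖a n‖ ≤ M) →
      ∀ x : X, ∃ y : X, ∀ n, S.coord y n = a n * S.coord x n)
    {p : Seminorm 𝕜 X} (hp : Continuous p) (x : X) {ε : ℝ} (hε : 0 < ε) :
    ∃ K, ∀ (F : Finset ι) (a : ι → 𝕜), (∀ i, ‖a i‖ ≤ 1) → Disjoint F (W K) →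
      p (S.multiplierSum e F a x) ≤ ε := by
  classical
  -- Gliding hump: otherwise there are successive disjoint blocks with multipliers of norm at most 1
  -- on which `p` exceeds `ε`. Glued into one bounded multiplier `α`, they contradict the
  -- convergence of the expansion of `α x`.
  by_contra! hcon
  choose F a ha hdisj hgt using hcon
  choose L hL hFL using fun K => exists_subset_of_exhaustion hW hex (F K) K
  let k : ℕ → ℕ := fun r => L^[r] 0
  have hksucc : ∀ r, k (r + 1) = L (k r) := fun r => Function.iterate_succ_apply' L r 0
  have hkmono : StrictMono k := strictMono_nat_of_lt_succ fun r => by rw [hksucc]; exact hL _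
  have hF1 : ∀ r r', r < r' → F (k r) ⊆ W (k r') := fun r r' h =>
    (hFL (k r)).trans (hW (by rw [← hksucc]; exact hkmono.monotone h))
  have hF2 : ∀ r r', r' ≤ r → Disjoint (F (k r)) (W (k r')) := fun r r' h =>
    (hdisj (k r)).mono_right (hW (hkmono.monotone h))
  let α : ι → 𝕜 := fun i => if h : ∃ r, i ∈ F (k r) then a (k h.choose) i else 0
  have hα0 : ∀ r i, i ∈ W (k (r + 1)) → i ∉ W (k r) → i ∉ F (k r) → α i = 0 := by
    intro r i h1 h2 h3
    refine dif_neg ?_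
    rintro ⟨r', h4⟩
    rcases lt_trichotomy r' r with h | rfl | h
    · exact h2 (hF1 _ _ h h4)
    · exact h3 h4
    · exact Finset.disjoint_left.1 (hF2 r' (r + 1) h) h4 h1
  have hα1 : ∀ r i, i ∈ F (k r) → α i = a (k r) i := by
    intro r i h
    have hh : ∃ r, i ∈ F (k r) := ⟨r, h⟩
    have h1 := hh.choose_spec
    have h2 : hh.choose = r := by
      rcases lt_trichotomy hh.choose r with h3 | h3 | h3
      · exact absurd (hF1 _ _ h3 h1) (Finset.disjoint_left.1 (hF2 r r le_rfl) h)
      · exact h3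
      · exact absurd (hF1 _ _ h3 h) (Finset.disjoint_left.1 (hF2 _ _ le_rfl) h1)
    simp only [α, dif_pos hh, h2]
  have hαb : ∀ i, ‖α i‖ ≤ 1 := by
    intro i
    by_cases h : ∃ r, i ∈ F (k r)
    · simp only [α, dif_pos h]; exact ha _ _
    · simp only [α, dif_neg h, norm_zero]; exact zero_le_one
  obtain ⟨y, hy⟩ := hmul α ⟨1, hαb⟩ x
  have hdiff : ∀ r, (∑ i ∈ W (k (r + 1)), S.coord y i • e i) - ∑ i ∈ W (k r), S.coord y i • e i =
      S.multiplierSum e (F (k r)) (a (k r)) x := by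
    intro r
    rw [multiplierSum_apply, ← Finset.sum_sdiff (hW (hkmono.monotone (Nat.le_succ r))),
      add_sub_cancel_right]
    symm
    rw [Finset.sum_congr rfl fun i hi => by rw [← hα1 r i hi, ← hy]]
    refine Finset.sum_subset (fun i hi => Finset.mem_sdiff.2
      ⟨hF1 _ _ (Nat.lt_succ_self r) hi, Finset.disjoint_left.1 (hF2 r r le_rfl) hi⟩) ?_
    intro i hi hi'
    rw [Finset.mem_sdiff] at hi
    rw [hy, hα0 r i hi.1 hi.2 hi', zero_mul, zero_smul]
  have hlim : Tendsto (fun r => p (S.multiplierSum e (F (k r)) (a (k r)) x)) atTop (𝓝 0) := by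
    have h1 := (hexp y).comp hkmono.tendsto_atTop
    have h2 := (h1.comp (tendsto_add_atTop_nat 1)).sub h1
    rw [sub_self] at h2
    have h3 := (hp.tendsto 0).comp h2
    rw [map_zero] at h3
    refine h3.congr fun r => ?_
    simp only [Function.comp_apply]
    rw [hdiff]
  have := ge_of_tendsto' hlim fun r => (hgt (k r)).le
  linarith

/-- The seminorm is the supremum of `p` over all finitely supported multipliers bounded by 1. It is
finite at each vector by `exists_tail_le`, and continuous because the space is barrelled. -/
theorem exists_isSolid {S : FrechetSequenceSpace 𝕜 ι X} {e : ι → X}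
    {W : ℕ → Finset ι} (hW : Monotone W) (hex : ∀ i, ∃ K, i ∈ W K)
    (hexp : ∀ x, Tendsto (fun K => ∑ i ∈ W K, S.coord x i • e i) atTop (𝓝 x))
    (hmul : ∀ a : ι → 𝕜, (∃ M : ℝ, ∀ n, ‖a n‖ ≤ M) →
      ∀ x : X, ∃ y : X, ∀ n, S.coord y n = a n * S.coord x n)
    {p : Seminorm 𝕜 X} (hp : Continuous p) :
    ∃ q : Seminorm 𝕜 X, Continuous q ∧ p ≤ q ∧ S.IsSolid q := by
  classical
  have := S.barrelledSpace
  let P : Finset ι × {a : ι → 𝕜 // ∀ i, ‖a i‖ ≤ 1} → Seminorm 𝕜 X := fun j =>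
    p.comp (S.multiplierSum e j.1 j.2.1)
  have hP : ∀ j x, P j x = p (S.multiplierSum e j.1 j.2.1 x) := fun _ _ => rfl
  have hbdd : BddAbove (Set.range P) := by
    rw [Seminorm.bddAbove_range_iff]
    intro x
    obtain ⟨K, hK⟩ := exists_tail_le hW hex hexp hmul hp x zero_lt_one
    refine ⟨∑ i ∈ W K, p (S.coord x i • e i) + 1, ?_⟩
    rintro _ ⟨⟨F, a, ha⟩, rfl⟩
    simp only [hP]
    have h1 : S.multiplierSum e F a x =
        S.multiplierSum e (F ∩ W K) a x + S.multiplierSum e (F \ W K) a x := by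
      simp only [multiplierSum_apply]
      rw [add_comm, ← Finset.sdiff_inter_self_left, Finset.sum_sdiff Finset.inter_subset_left]
    rw [h1]
    refine (map_add_le_add p _ _).trans (add_le_add ?_ (hK _ a ha Finset.sdiff_disjoint))
    rw [multiplierSum_apply]
    calc p (∑ i ∈ F ∩ W K, (a i * S.coord x i) • e i)
        ≤ ∑ i ∈ F ∩ W K, p ((a i * S.coord x i) • e i) := Finset.le_sum_of_subadditive p (map_zero p).le (map_add_le_add p) _ _
      _ ≤ ∑ i ∈ F ∩ W K, p (S.coord x i • e i) := by
          refine Finset.sum_le_sum fun i _ => ?_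
          rw [mul_smul, map_smul_eq_mul]
          exact mul_le_of_le_one_left (apply_nonneg p _) (ha i)
      _ ≤ _ := Finset.sum_le_sum_of_subset_of_nonneg Finset.inter_subset_right
          fun _ _ _ => apply_nonneg p _
  have hbx : ∀ x, BddAbove (Set.range fun j => P j x) := Seminorm.bddAbove_range_iff.1 hbdd
  refine ⟨⨆ j, P j, ?_, ?_, ?_⟩
  · have := Seminorm.continuous_iSup P
      (fun j => hp.comp (S.continuous_multiplierSum e j.1 j.2.1)) hbdd
    rwa [Seminorm.coe_iSup_eq hbdd]
  · intro x
    rw [Seminorm.iSup_apply hbdd]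
    refine le_of_tendsto' ((hp.tendsto x).comp (hexp x)) fun K => ?_
    refine le_trans (le_of_eq ?_) (le_ciSup (hbx x) (W K, ⟨fun _ => 1, by simp⟩))
    simp [hP, multiplierSum_apply]
  · intro x y hxy
    rw [Seminorm.iSup_apply hbdd, Seminorm.iSup_apply hbdd]
    have : Nonempty (Finset ι × {a : ι → 𝕜 // ∀ i, ‖a i‖ ≤ 1}) := ⟨(∅, ⟨fun _ => 0, by simp⟩)⟩
    refine ciSup_le ?_
    rintro ⟨F, a, ha⟩
    -- The quotient of coordinates is absorbed into the multiplier. Where `x` vanishes so does `y`,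
    -- and division by zero gives the harmless value 0.
    let b : ι → 𝕜 := fun i => a i * (S.coord y i / S.coord x i)
    have hb : ∀ i, ‖b i‖ ≤ 1 := by
      intro i
      rw [norm_mul, norm_div]
      exact mul_le_one₀ (ha i) (by positivity) (div_le_one_of_le₀ (hxy i) (norm_nonneg _))
    refine le_trans (le_of_eq ?_) (le_ciSup (hbx x) (F, ⟨b, hb⟩))
    simp only [hP, multiplierSum_apply]
    congr 1
    refine Finset.sum_congr rfl fun i _ => ?_
    congr 1
    by_cases h : S.coord x i = 0
    · have h2 : S.coord y i = 0 := by simpa [h] using hxy i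
      simp [h, h2]
    · simp only [b]; field_simp

/-- On `F`, the difference is dominated by `x' - x`. Off `F`, `u` and `v` are dominated by `x'` and
`x`, and the tail of `x'` costs the tail of `x` plus another `q (x' - x)`. -/
theorem IsSolid.apply_sub_le [DecidableEq ι] {S : FrechetSequenceSpace 𝕜 ι X} {e : ι → X}
    (he : ∀ i, S.coord (e i) = Pi.single i 1) {q : Seminorm 𝕜 X} (hq : S.IsSolid q)
    (F : Finset ι) {u v x x' : X}
    (h : ∀ i ∈ F, ‖S.coord u i - S.coord v i‖ ≤ ‖S.coord x' i - S.coord x i‖)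
    (hu : ∀ i, ‖S.coord u i‖ ≤ ‖S.coord x' i‖) (hv : ∀ i, ‖S.coord v i‖ ≤ ‖S.coord x i‖) :
    q (u - v) ≤ 2 * q (x - ∑ i ∈ F, S.coord x i • e i) + 2 * q (x' - x) := by
  let R : X →ₗ[𝕜] X := LinearMap.id - S.multiplierSum e F fun _ => 1
  have hR : ∀ z, R z = z - ∑ i ∈ F, S.coord z i • e i := by
    intro z; simp [R, multiplierSum_apply]
  have hRc : ∀ z i, S.coord (R z) i = if i ∈ F then 0 else S.coord z i := by
    intro z i
    rw [hR, map_sub, Pi.sub_apply, coord_sum_smul he]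
    split_ifs <;> simp
  have hRmono : ∀ z w, (∀ i, ‖S.coord z i‖ ≤ ‖S.coord w i‖) → q (R z) ≤ q (R w) := by
    intro z w hzw
    refine hq _ _ fun i => ?_
    rw [hRc, hRc]
    split_ifs
    · simp
    · exact hzw i
  have hRle : ∀ z, q (R z) ≤ q z := by
    intro z
    refine hq _ _ fun i => ?_
    rw [hRc]
    split_ifs <;> simp
  have h1 : q ((u - v) - R (u - v)) ≤ q (x' - x) := by
    refine hq _ _ fun i => ?_
    rw [map_sub, Pi.sub_apply, hRc]
    split_ifs with hi
    · simpa using h i hi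
    · simp
  have h2 : q (R x') ≤ q (R x) + q (x' - x) := by
    have : R x' = R x + R (x' - x) := by rw [map_sub]; abel
    rw [this]
    exact (map_add_le_add q _ _).trans (add_le_add le_rfl (hRle _))
  have h3 : q (u - v) ≤ q ((u - v) - R (u - v)) + (q (R u) + q (R v)) := by
    have h4 : u - v = ((u - v) - R (u - v)) + (R u - R v) := by rw [map_sub]; abel
    calc q (u - v) = q (((u - v) - R (u - v)) + (R u - R v)) := by rw [← h4]
      _ ≤ _ := (map_add_le_add q _ _).trans (add_le_add le_rfl (map_sub_le_add q _ _))
  have h5 := hRmono u x' hu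
  have h6 := hRmono v x hv
  rw [← hR]
  linarith

theorem exists_seminorm_lt_imp_mem (S : FrechetSequenceSpace 𝕜 ι X) {U : Set X} {y : X}
    (hU : U ∈ 𝓝 y) : ∃ M, ∃ r > 0, ∀ z, S.seminorm M (z - y) < r → z ∈ U := by
  obtain ⟨s, r, hr, hs⟩ := (S.withSeminorms.mem_nhds_iff y U).1 hU
  refine ⟨s.sup id, r, hr, fun z hz => hs ?_⟩
  rw [Seminorm.mem_ball]
  refine lt_of_le_of_lt ?_ hz
  have : s.sup S.seminorm ≤ S.seminorm (s.sup id) :=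
    Finset.sup_le fun i hi => S.seminorm_mono (Finset.le_sup (f := id) hi)
  exact this _

/-- A backward shift is a continuous linear operator. -/
theorem exists_continuousLinearMap_eq [Add ι] [One ι] {S : FrechetSequenceSpace 𝕜 ι X} {e : ι → X}
    {W : ℕ → Finset ι}
    (hexp : ∀ x, Tendsto (fun K => ∑ i ∈ W K, S.coord x i • e i) atTop (𝓝 x))
    {B : X → X} (hB : S.IsBackwardShift B) : ∃ T : X →L[𝕜] X, ⇑T = B := by
  have := S.continuousSMul
  have := S.barrelledSpace
  have := S.t2Space
  have : PolynormableSpace 𝕜 X := S.withSeminorms.toPolynormableSpace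
  let φ : ι → X →L[𝕜] 𝕜 := fun i => ⟨LinearMap.proj i ∘ₗ S.coord, S.continuous_coord i⟩
  let g : ℕ → X →L[𝕜] X := fun K => ∑ i ∈ W K, (φ (i + 1)).smulRight (e i)
  -- Banach–Steinhaus: `B` is the pointwise limit of its finite-rank truncations, which are
  -- continuous since the coordinates are.
  refine ⟨continuousLinearMapOfTendsto g (f := B) (l := atTop) ?_, rfl⟩
  rw [tendsto_pi_nhds]
  intro x
  refine (hexp (B x)).congr fun K => ?_
  simp only [g, _root_.sum_apply, ContinuousLinearMap.smulRight_apply]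
  exact Finset.sum_congr rfl fun i _ => by rw [hB]; rfl

end FrechetSequenceSpace

/-! ### Transfer of frequent recurrence and dense lineability. -/

theorem IsFrequentlyRecurrentVector.map {Y Z : Type*} [TopologicalSpace Y] [TopologicalSpace Z]
    {T : Y → Y} {R : Z → Z} {f : Y → Z} (hf : Continuous f) (hTR : Function.Semiconj f T R) {x : Y}
    (hx : IsFrequentlyRecurrentVector T x) : IsFrequentlyRecurrentVector R (f x) := by
  intro U hU hxU
  refine lowerDensity_pos_mono (fun n hn => ?_) (hx (f ⁻¹' U) (hU.preimage hf) hxU)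
  change R^[n] (f x) ∈ U
  rw [← hTR.iterate_right n x]
  exact hn

section Lineable

variable {𝕜 X : Type*} [RCLike 𝕜] [AddCommGroup X] [Module 𝕜 X] [TopologicalSpace X]
  [IsTopologicalAddGroup X] [ContinuousConstSMul 𝕜 X]

theorem exists_commute_of_mem_span_orbit (T : X →L[𝕜] X) {x v : X}
    (hv : v ∈ Submodule.span 𝕜 (Set.range fun n : ℕ => T^[n] x)) :
    ∃ L : X →L[𝕜] X, L x = v ∧ ∀ z, L (T z) = T (L z) := by
  induction hv using Submodule.span_induction with
  | mem v hv =>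
    obtain ⟨n, rfl⟩ := hv
    refine ⟨T ^ n, by simp, fun z => ?_⟩
    rw [← mul_apply_eq_comp, ← mul_apply_eq_comp, ← pow_succ, ← pow_succ']
  | zero => exact ⟨0, by simp, by simp⟩
  | add v w _ _ h1 h2 =>
    obtain ⟨L, rfl, hL⟩ := h1
    obtain ⟨M, rfl, hM⟩ := h2
    exact ⟨L + M, by simp, fun z => by simp [hL, hM]⟩
  | smul a v _ h =>
    obtain ⟨L, rfl, hL⟩ := h
    exact ⟨a • L, by simp, fun z => by simp [hL]⟩

theorem isFrequentlyRecurrentVector_of_mem_span_orbit (T : X →L[𝕜] X) {x : X}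
    (hx : IsFrequentlyRecurrentVector T x) {v : X}
    (hv : v ∈ Submodule.span 𝕜 (Set.range fun n : ℕ => T^[n] x)) :
    IsFrequentlyRecurrentVector T v := by
  obtain ⟨L, rfl, hL⟩ := exists_commute_of_mem_span_orbit T hv
  exact hx.map L.continuous hL

theorem isDenseLineable_of_isCyclicVector (T : X →L[𝕜] X) {x : X} (hc : IsCyclicVector 𝕜 T x)
    (hx : IsFrequentlyRecurrentVector T x) :
    IsDenseLineable 𝕜 {x : X | IsFrequentlyRecurrentVector T x} :=
  ⟨_, hc, fun _ hv => Or.inl (isFrequentlyRecurrentVector_of_mem_span_orbit T hx hv)⟩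

theorem isDenseLineable_nfoldProduct_of_isCyclicVector (T : X →L[𝕜] X) {x : X}
    (hc : IsCyclicVector 𝕜 T x) (hx : IsFrequentlyRecurrentVector T x) (n : ℕ) :
    IsDenseLineable 𝕜 {x : Fin n → X | IsFrequentlyRecurrentVector (nfoldProduct T n) x} := by
  refine ⟨Submodule.pi Set.univ fun _ => Submodule.span 𝕜 (Set.range fun n : ℕ => T^[n] x),
    ?_, fun v hv => Or.inl ?_⟩
  · rw [Submodule.coe_pi]
    exact dense_pi _ fun _ _ => hc
  · choose L hLx hL using fun i =>
      exists_commute_of_mem_span_orbit T (Submodule.mem_pi.1 hv i (Set.mem_univ i))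
    have h := hx.map (R := nfoldProduct T n) (f := fun z i => L i z)
      (continuous_pi fun i => (L i).continuous) fun z => funext fun i => hL i z
    rwa [show (fun i => L i x) = v from funext hLx] at h

end Lineable

/-! ### Backward shifts: construction of the cyclic vector. -/

namespace FrechetSequenceSpace

variable {𝕜 ι X : Type*} [RCLike 𝕜]
  [AddCommGroup X] [Module 𝕜 X] [UniformSpace X] [IsUniformAddGroup X] [CompleteSpace X]

theorem IsBackwardShift.coord_iterate [AddMonoidWithOne ι] {S : FrechetSequenceSpace 𝕜 ι X}
    {B : X → X} (hB : S.IsBackwardShift B) (n : ℕ) (x : X) (i : ι) :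
    S.coord (B^[n] x) i = S.coord x (i + n) := by
  induction n generalizing x with
  | zero => simp
  | succ n ih => rw [Function.iterate_succ_apply, ih, hB, Nat.cast_succ, add_assoc]

/-- A vector is cyclic for a backward shift if its orbit accumulates at multiples of unit vectors
arbitrarily far to the right. -/
theorem isCyclicVector_of_forall_exists [AddMonoidWithOne ι] [IsRightCancelAdd ι] [DecidableEq ι]
    {S : FrechetSequenceSpace 𝕜 ι X} {e : ι → X} {W : ℕ → Finset ι}
    (he : ∀ i, S.coord (e i) = Pi.single i 1)
    (hexp : ∀ x, Tendsto (fun K => ∑ i ∈ W K, S.coord x i • e i) atTop (𝓝 x))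
    (T : X →L[𝕜] X) (hT : S.IsBackwardShift T) {y : X}
    (hy : ∀ i : ι, ∃ n : ℕ, ∃ a : 𝕜, a ≠ 0 ∧
      a • e (i + n) ∈ closure (Set.range fun n : ℕ => T^[n] y)) :
    IsCyclicVector 𝕜 T y := by
  have := S.continuousSMul
  set V := Submodule.span 𝕜 (Set.range fun n : ℕ => T^[n] y) with hV
  set Z := V.topologicalClosure with hZ
  have hVT : ∀ v ∈ V, T v ∈ V := by
    intro v hv
    have h : V ≤ V.comap (T : X →ₗ[𝕜] X) := by
      rw [hV, Submodule.span_le]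
      rintro _ ⟨n, rfl⟩
      refine Submodule.subset_span ⟨n + 1, ?_⟩
      exact Function.iterate_succ_apply' T n y
    exact h hv
  have hZT : ∀ v ∈ Z, T v ∈ Z := fun v hv => map_mem_closure T.continuous hv hVT
  have hZTn : ∀ n : ℕ, ∀ v ∈ Z, T^[n] v ∈ Z := by
    intro n
    induction n with
    | zero => exact fun v hv => hv
    | succ n ih => exact fun v hv => ih _ (hZT v hv)
  have hTe : ∀ (n : ℕ) i, T^[n] (e (i + n)) = e i := by
    intro n i
    apply S.coord_injective
    funext k
    rw [hT.coord_iterate, he, he, Pi.single_apply, Pi.single_apply]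
    simp only [add_left_inj]
  have heZ : ∀ i, e i ∈ Z := by
    intro i
    obtain ⟨n, a, ha, h⟩ := hy i
    have h1 : a • e (i + n) ∈ Z := closure_mono Submodule.subset_span h
    have h2 : e (i + n) ∈ Z := (Submodule.smul_mem_iff Z ha).1 h1
    rw [← hTe n i]
    exact hZTn n _ h2
  intro x
  change x ∈ Z
  exact V.isClosed_topologicalClosure.mem_of_tendsto (hexp x)
    (Eventually.of_forall fun K => Submodule.sum_mem _ fun i _ => Submodule.smul_mem _ _ (heZ i))

/-- The passage from one frequently recurrent vector to a cyclic one. The index set is embedded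
by `c` into the integers as an upward closed set. -/
theorem exists_isCyclicVector_isFrequentlyRecurrentVector [AddMonoidWithOne ι] [IsRightCancelAdd ι]
    [DecidableEq ι] {S : FrechetSequenceSpace 𝕜 ι X} {e : ι → X} {W : ℕ → Finset ι}
    (c : ι → ℤ) (hcinj : Function.Injective c) (hcadd : ∀ i (n : ℕ), c (i + n) = c i + n)
    (hcle : ∀ i j, c i ≤ c j → ∃ n : ℕ, j = i + n) (hcW : ∀ K i, i ∈ W K ↔ |c i| ≤ K)
    (he : ∀ i, S.coord (e i) = Pi.single i 1)
    (hexp : ∀ x, Tendsto (fun K => ∑ i ∈ W K, S.coord x i • e i) atTop (𝓝 x))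
    (hmul : ∀ a : ι → 𝕜, (∃ M : ℝ, ∀ n, ‖a n‖ ≤ M) →
      ∀ x : X, ∃ y : X, ∀ n, S.coord y n = a n * S.coord x n)
    (T : X →L[𝕜] X) (hT : S.IsBackwardShift T) {x : X} {i₀ : ι} (hx₀ : S.coord x i₀ ≠ 0)
    (hx : IsFrequentlyRecurrentVector T x) :
    ∃ y, IsCyclicVector 𝕜 T y ∧ IsFrequentlyRecurrentVector T y := by
  classical
  have hW : Monotone W := by
    intro K L hKL i hi
    rw [hcW] at hi ⊢
    exact hi.trans (by exact_mod_cast hKL)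
  have hex : ∀ i, ∃ K, i ∈ W K := fun i => ⟨(c i).natAbs, by rw [hcW]; simp⟩
  choose q hqc hpq hqs using fun m =>
    exists_isSolid hW hex hexp hmul (S.withSeminorms.continuous_seminorm m)
  let A : ℕ → Set ℕ := fun m => {n | ∀ l ≤ m, q l (T^[n] x - x) < 1 / ((m : ℝ) + 1)}
  have hA : ∀ m, 0 < lowerDensity (A m) := by
    intro m
    refine hx {z | ∀ l ≤ m, q l (z - x) < 1 / ((m : ℝ) + 1)} ?_ ?_
    · have h : {z | ∀ l ≤ m, q l (z - x) < 1 / ((m : ℝ) + 1)} =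
          ⋂ l ∈ Set.Iic m, {z | q l (z - x) < 1 / ((m : ℝ) + 1)} := by
        ext z; simp
      rw [h]
      exact (Set.finite_Iic m).isOpen_biInter fun l _ =>
        isOpen_lt ((hqc l).comp (continuous_id.sub continuous_const)) continuous_const
    · intro l _
      rw [sub_self, map_zero]
      positivity
  -- The first component of `Nat.unpair` takes each natural number at arbitrarily large `m`, so each
  -- target position is isolated in arbitrarily large windows.
  obtain ⟨s, hs1, hs2⟩ := exists_recurrent_set A hA fun m => ((Nat.unpair m).1 : ℤ)
  obtain ⟨y, hy⟩ := hmul (fun i => if c i ∈ s then 1 else 0)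
    ⟨1, fun i => by split_ifs <;> simp⟩ x
  have hyn : ∀ (n : ℕ) i, S.coord (T^[n] y) i =
      if (n : ℤ) + c i ∈ s then S.coord (T^[n] x) i else 0 := by
    intro n i
    rw [hT.coord_iterate, hT.coord_iterate, hy, hcadd, add_comm (c i)]
    split_ifs <;> simp
  have hy0 : ∀ i, S.coord y i = if c i ∈ s then S.coord x i else 0 := by
    intro i; simpa using hyn 0 i
  have hyle : ∀ (n : ℕ) i, ‖S.coord (T^[n] y) i‖ ≤ ‖S.coord (T^[n] x) i‖ := by
    intro n i
    rw [hyn]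
    split_ifs <;> simp
  have hsmall : ∀ (l : ℕ) (r : ℝ), 0 < r → ∃ K, ∀ m ≥ K, ∀ n ∈ A m,
      2 * q l (x - ∑ i ∈ W m, S.coord x i • e i) + 2 * q l (T^[n] x - x) < r := by
    intro l r hr
    have h1 : Tendsto (fun m => q l (x - ∑ i ∈ W m, S.coord x i • e i)) atTop (𝓝 0) := by
      have := ((hqc l).tendsto _).comp ((tendsto_const_nhds (x := x)).sub (hexp x))
      rwa [sub_self, map_zero] at this
    have h2 : Tendsto (fun m => 2 * q l (x - ∑ i ∈ W m, S.coord x i • e i) +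
        2 * (1 / ((m : ℝ) + 1))) atTop (𝓝 0) := by
      simpa using (h1.const_mul 2).add (tendsto_one_div_add_atTop_nhds_zero_nat.const_mul 2)
    obtain ⟨K, hK⟩ := eventually_atTop.1 (h2.eventually_lt_const hr)
    refine ⟨max K l, fun m hm n hn => lt_of_le_of_lt ?_ (hK m (le_of_max_le_left hm))⟩
    have := (hn l (le_of_max_le_right hm)).le
    gcongr
  refine ⟨y, isCyclicVector_of_forall_exists he hexp T hT fun i => ?_, ?_⟩
  · obtain ⟨n, hn, hnx⟩ : ∃ n : ℕ, (c i - c i₀).natAbs + (c i₀).natAbs ≤ n ∧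
        S.coord x (i₀ + n) ≠ 0 := by
      have hU : IsOpen {z : X | S.coord z i₀ ≠ 0} :=
        isOpen_ne_fun (S.continuous_coord i₀) continuous_const
      obtain ⟨n, hn, hlt⟩ := (infinite_of_lowerDensity_pos (hx _ hU hx₀)).exists_gt
        ((c i - c i₀).natAbs + (c i₀).natAbs)
      refine ⟨n, hlt.le, ?_⟩
      rw [← hT.coord_iterate]
      exact hn
    obtain ⟨k, hk⟩ := hcle i (i₀ + n) (by rw [hcadd]; omega)
    set j := i₀ + (n : ι) with hj
    have hcj : 0 ≤ c j := by rw [hj, hcadd]; omega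
    refine ⟨k, S.coord x j, hnx, ?_⟩
    rw [← hk, mem_closure_iff_nhds]
    intro U hU
    obtain ⟨l, r, hr, hlr⟩ := S.exists_seminorm_lt_imp_mem hU
    obtain ⟨K, hK⟩ := hsmall l r hr
    obtain ⟨m', hm'⟩ : ∃ m', m' = Nat.pair (c j).toNat K := ⟨_, rfl⟩
    have hKm : K ≤ m' := hm' ▸ Nat.right_le_pair _ _
    obtain ⟨t, htA, ht⟩ := hs2 m'
    have hJ : ((Nat.unpair m').1 : ℤ) = c j := by rw [hm', Nat.unpair_pair]; simp [hcj]
    rw [hJ] at ht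
    refine ⟨T^[t] y, hlr _ ?_, t, rfl⟩
    have hce : ∀ i, S.coord (S.coord x j • e j) i = if i = j then S.coord x i else 0 := by
      intro i
      rw [map_smul, he, Pi.smul_apply, Pi.single_apply, smul_eq_mul]
      split_ifs with h
      · rw [mul_one, h]
      · rw [mul_zero]
    -- In the window, `T^[t] y` keeps only the coordinate `j` of `T^[t] x`; it is compared with the
    -- same truncation of `x`.
    refine lt_of_le_of_lt ((hpq l _).trans ((hqs l).apply_sub_le he (W m') (x := x) (x' := T^[t] x)
      (fun i hi => ?_) (hyle t) fun i => ?_)) (hK m' hKm t htA)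
    · rw [hyn, hce]
      have h1 := ht (c i) ((hcW _ _).1 hi)
      by_cases hij : i = j
      · rw [if_pos (h1.2 (by rw [hij])), if_pos hij]
      · rw [if_neg fun h => hij (hcinj (h1.1 h)), if_neg hij]
        simp
    · rw [hce]
      split_ifs <;> simp
  · intro U hU hyU
    obtain ⟨l, r, hr, hlr⟩ := S.exists_seminorm_lt_imp_mem (hU.mem_nhds hyU)
    obtain ⟨K, hK⟩ := hsmall l r hr
    refine lowerDensity_pos_mono (fun n hn => ?_) (hs1 K)
    obtain ⟨hnA, hns⟩ := hn
    -- In the window, `s` around `n` agrees with `s` around 0, so the same coordinates of `T^[n] x`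
    -- and `x` are kept.
    refine hlr _ (lt_of_le_of_lt ((hpq l _).trans ((hqs l).apply_sub_le he (W K) (x := x)
      (x' := T^[n] x) (fun i hi => ?_) (hyle n) (hyle 0))) (hK K le_rfl n hnA))
    rw [hyn, hy0]
    have h1 := hns (c i) ((hcW _ _).1 hi)
    by_cases h : c i ∈ s
    · rw [if_pos (h1.2 h), if_pos h]
    · rw [if_neg fun h' => h (h1.1 h'), if_neg h]
      simp

theorem frequentlyRecurrent_backwardShift [AddMonoidWithOne ι] [IsRightCancelAdd ι]
    [DecidableEq ι] {S : FrechetSequenceSpace 𝕜 ι X} {e : ι → X} {B : X → X} {W : ℕ → Finset ι}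
    (c : ι → ℤ) (hcinj : Function.Injective c) (hcadd : ∀ i (n : ℕ), c (i + n) = c i + n)
    (hcle : ∀ i j, c i ≤ c j → ∃ n : ℕ, j = i + n) (hcW : ∀ K i, i ∈ W K ↔ |c i| ≤ K)
    (he : ∀ i, S.coord (e i) = Pi.single i 1)
    (hexp : ∀ x, Tendsto (fun K => ∑ i ∈ W K, S.coord x i • e i) atTop (𝓝 x))
    (hmul : ∀ a : ι → 𝕜, (∃ M : ℝ, ∀ n, ‖a n‖ ≤ M) →
      ∀ x : X, ∃ y : X, ∀ n, S.coord y n = a n * S.coord x n)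
    (hB : S.IsBackwardShift B) :
    (IsFrequentlyRecurrent B ↔
      ∃ x : X, IsCyclicVector 𝕜 B x ∧ IsFrequentlyRecurrentVector B x) ∧
    (IsFrequentlyRecurrent B →
      IsDenseLineable 𝕜 {x : X | IsFrequentlyRecurrentVector B x} ∧
      ∀ n : ℕ, IsDenseLineable 𝕜
        {x : Fin n → X | IsFrequentlyRecurrentVector (nfoldProduct B n) x}) := by
  have := S.continuousSMul
  obtain ⟨T, rfl⟩ := exists_continuousLinearMap_eq hexp hB
  have key : IsFrequentlyRecurrent T →
      ∃ x : X, IsCyclicVector 𝕜 T x ∧ IsFrequentlyRecurrentVector T x := by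
    intro hFR
    have hU : IsOpen {z : X | S.coord z 0 ≠ 0} :=
      isOpen_ne_fun (S.continuous_coord 0) continuous_const
    obtain ⟨x, hx0, hx⟩ := hFR.inter_open_nonempty _ hU ⟨e 0, by simp [he]⟩
    exact exists_isCyclicVector_isFrequentlyRecurrentVector c hcinj hcadd hcle hcW he hexp hmul T hB
      hx0 hx
  refine ⟨⟨key, ?_⟩, fun hFR => ?_⟩
  · rintro ⟨x, hc, hx⟩
    exact hc.mono fun v hv => isFrequentlyRecurrentVector_of_mem_span_orbit T hx hv
  · obtain ⟨x, hc, hx⟩ := key hFR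
    exact ⟨isDenseLineable_of_isCyclicVector T hc hx,
      isDenseLineable_nfoldProduct_of_isCyclicVector T hc hx⟩

end FrechetSequenceSpace

theorem mainTheorem2 {𝕜 : Type*} [RCLike 𝕜] {X : Type*} [AddCommGroup X] [Module 𝕜 X]
    [UniformSpace X] [IsUniformAddGroup X] [CompleteSpace X] :
    -- the unilateral backward shift
    (∀ (S : FrechetSequenceSpace 𝕜 ℕ X) (e : ℕ → X) (B : X → X),
      S.IsUnconditionalBasis e → S.IsBackwardShift B →
        (IsFrequentlyRecurrent B ↔
          ∃ x : X, IsCyclicVector 𝕜 B x ∧ IsFrequentlyRecurrentVector B x) ∧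
        (IsFrequentlyRecurrent B →
          IsDenseLineable 𝕜 {x : X | IsFrequentlyRecurrentVector B x} ∧
          ∀ n : ℕ, IsDenseLineable 𝕜
            {x : Fin n → X | IsFrequentlyRecurrentVector (nfoldProduct B n) x})) ∧
    -- the bilateral backward shift
    (∀ (S : FrechetSequenceSpace 𝕜 ℤ X) (e : ℤ → X) (B : X → X),
      S.IsUnconditionalBasis e → S.IsBackwardShift B →
        (IsFrequentlyRecurrent B ↔
          ∃ x : X, IsCyclicVector 𝕜 B x ∧ IsFrequentlyRecurrentVector B x) ∧
        (IsFrequentlyRecurrent B →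
          IsDenseLineable 𝕜 {x : X | IsFrequentlyRecurrentVector B x} ∧
          ∀ n : ℕ, IsDenseLineable 𝕜
            {x : Fin n → X | IsFrequentlyRecurrentVector (nfoldProduct B n) x})) := by
  refine ⟨fun S e B he hB => ?_, fun S e B he hB => ?_⟩
  · refine FrechetSequenceSpace.frequentlyRecurrent_backwardShift (e := e)
      (W := fun K => Finset.range (K + 1)) (fun i => (i : ℤ)) Nat.cast_injective
      (fun i n => by simp) (fun i j h => ⟨j - i, by simp only [Nat.cast_le, Nat.cast_id] at *; omega⟩)
      (fun K i => by simp only [Finset.mem_range, Nat.abs_cast]; omega)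
      he.coord_basis (fun x => ?_) he.mul_mem hB
    have h : Tendsto _ _ _ := he.expansion x
    rw [SummationFilter.conditional_filter_eq_map_range, tendsto_map'_iff] at h
    exact h.comp (tendsto_add_atTop_nat 1)
  · refine FrechetSequenceSpace.frequentlyRecurrent_backwardShift (e := e)
      (W := fun K => Finset.Icc (-(K : ℤ)) K) id Function.injective_id
      (fun i n => rfl) (fun i j h => ⟨(j - i).toNat, by simp only [id] at *; omega⟩)
      (fun K i => by simp [abs_le])
      he.coord_basis (fun x => ?_) he.mul_mem hB
    have h : Tendsto _ _ _ := he.expansion x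
    rw [SummationFilter.conditional_filter, tendsto_map'_iff] at h
    -- Symmetric partial sums suffice; they are the restriction of the two-sided limit to `M = -K`,
    -- `N = K`.
    have h1 : Tendsto (fun K : ℕ => (-(K : ℤ), (K : ℤ))) atTop (atBot ×ˢ atTop) :=
      (tendsto_neg_atTop_atBot.comp tendsto_natCast_atTop_atTop).prodMk tendsto_natCast_atTop_atTop
    exact (h.comp h1).congr fun K => rfl
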